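/- Let $G$ be a compact (Hausdorff) abelian group with discrete dual group $\Gamma$, written multiplicatively with identity $\mathbf 1$. A set $E\subseteq\Gamma$ is called Sidon if there is a constant $C$ such that for every bounded function $\phi:E\to\mathbb{C}$ there is a regular complex Borel measure $\mu$ on $G$ with $\widehat{\mu}(\gamma)=\int_G\overline{\gamma(x)}\,d\mu(x)=\phi(\gamma)$ for all $\gamma\in E$ and total variation norm $\|\mu\|\le C\|\phi\|_\infty$. For $n\in\mathbb{N}$, a set $H\subseteq\Gamma$ is called $n$-degree independent if, whenever $\gamma_1,\dots,\gamma_k$ are distinct elements of $H$ and $m_1,\dots,m_k$ are integers with $|m_i|\le n$, the equation $\prod_{i=1}^k\gamma_i^{m_i}=\mathbf 1$ implies $\gamma_i^{m_i}=\mathbf 1$ for all $i=1,\dots,k$. **Proposition 3.3.** Let $n\in\mathbb{N}$ and assume that $\Gamma$ contains no non-trivial elements of (finite) order $\le n$. Let $E\subseteq\Gamma\setminus\{\mathbf 1\}$ be such that $E_k=\{\gamma^k:\gamma\in E\}$ is Sidon for each $k=1,\dots,n$. Then there exists $\delta_n>0$ such that every finite set $F\subseteq E$ contains a finite subset $H\subseteq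 F$ which is $n$-degree independent and satisfies $|H|\ge\delta_n|F|$. -/

import Mathlib

open MeasureTheory
open scoped ENNReal

/-- The Fourier-Stieltjes transform `μ̂(γ) = ∫ conj (γ x) dμ(x)` of a complex Borel measure `μ`
on `G`, at a character `γ` of `G`. The pairing of the integrand with `μ` is multiplication in `ℂ`. -/
noncomputable def fourierStieltjes {G : Type*} [CommGroup G] [TopologicalSpace G]
    [MeasurableSpace G] (μ : ComplexMeasure G) (γ : PontryaginDual G) : ℂ :=
  VectorMeasure.integral μ (fun x : G => (starRingEnd ℂ) ((γ x : Circle) : ℂ))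
    (ContinuousLinearMap.mul ℝ ℂ)

/-- `E` is a Sidon set: there is a constant `C` such that every bounded `φ : E → ℂ` is the
restriction to `E` of the Fourier-Stieltjes transform of some `μ` in `M(G)`, the regular complex
Borel measures on `G`, with total variation norm `‖μ‖ ≤ C ‖φ‖_∞`.
(`⨆ γ : E, ‖φ γ‖` is the sup norm; it is `0` when `E` is empty.) -/
def IsSidon {G : Type*} [CommGroup G] [TopologicalSpace G] [MeasurableSpace G]
    (E : Set (PontryaginDual G)) : Prop :=
  ∃ C : ℝ, ∀ φ : E → ℂ, BddAbove (Set.range fun γ : E => ‖φ γ‖) →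
    ∃ μ : ComplexMeasure G, μ.variation.Regular ∧
      (∀ γ : E, fourierStieltjes μ γ = φ γ) ∧
      μ.variation Set.univ ≤ ENNReal.ofReal (C * ⨆ γ : E, ‖φ γ‖)

/-- `E` is `n`-degree independent: if `γ₁, …, γ_k` are distinct elements of `E` (the elements of
the finite set `s`), `|mᵢ| ≤ n` and `∏ γᵢ ^ mᵢ = 1`, then `γᵢ ^ mᵢ = 1` for every `i`. -/
def IsDegreeIndependent {Γ : Type*} [CommGroup Γ] (n : ℕ) (E : Set Γ) : Prop :=
  ∀ (s : Finset Γ) (m : Γ → ℤ), (s : Set Γ) ⊆ E → (∀ γ ∈ s, |m γ| ≤ (n : ℤ)) →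
    ∏ γ ∈ s, γ ^ m γ = 1 → ∀ γ ∈ s, γ ^ m γ = 1

/-! Let N = |F|. The proof counts relations ∏ γ ^ r γ = 1 on F with |r γ| ≤ n, each weighted by p ^
|supp r|. By orthogonality of characters this count is the Haar integral of ∏ (1 + p ∑ γ ^ j), the
inner sum over 0 < |j| ≤ n (`sum_relations_eq_integral`). The integrand is at most exp(O(p² N))
times a sum of exponentials of the power sums ‖∑ γ ^ j‖.

Rudin's estimate (`IsSidon.exists_integral_exp_le`) controls these: on a Sidon set any signs are
interpolated by a measure of bounded mass, so ∑ γ is a convolution of that measure with ∑ ε γ, and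
averaging over signs gives subgaussian behaviour. Absence of small torsion makes γ ↦ γ ^ k injective
on F, so the power sums have N distinct terms in E_k. Hence the count is at most A exp(D p² N).

Now take a random subset of density q. Discarding relations of support below qN/4 gains exp(-qN/4)
at the price of p = e q. The gain is linear in q and the loss quadratic, so for small q and large N
some subset of size at least qN/2 contains no long relation. Deleting a relation of maximal support
there leaves an independent set. -/

/-! ### Random subsets avoiding a family of supports -/

/-- The probability that a random subset of `ι`, containing each point independently with
probability `q`, contains `S` is `q ^ #S`. -/
theorem sum_superset_weight {ι : Type*} [Fintype ι] [DecidableEq ι] (q : ℝ) (S : Finset ι) :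
    ∑ R : Finset ι, (if S ⊆ R then q ^ R.card * (1 - q) ^ Rᶜ.card else 0) = q ^ S.card := by
  -- Omitting a point of `S` is given weight 0, so only supersets of `S` survive the expansion.
  have h := Finset.prod_add (fun _ : ι => q) (fun i => if i ∈ S then 0 else 1 - q) Finset.univ
  have h1 : ∀ i, q + (if i ∈ S then 0 else 1 - q) = if i ∈ S then q else 1 := by
    intro i; split_ifs <;> ring
  simp only [h1, Finset.powerset_univ, Finset.prod_const] at h
  rw [Finset.prod_ite, Finset.prod_const, Finset.prod_const_one, mul_one,
    Finset.filter_univ_mem] at h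
  rw [h]
  refine Finset.sum_congr rfl fun R _ => ?_
  split_ifs with hS
  · congr 1
    rw [Finset.compl_eq_univ_sdiff, ← Finset.prod_const]
    refine Finset.prod_congr rfl fun i hi => ?_
    rw [if_neg]
    exact fun hiS => (Finset.mem_sdiff.1 hi).2 (hS hiS)
  · obtain ⟨i, hiS, hiR⟩ := Finset.not_subset.1 hS
    symm
    apply mul_eq_zero_of_right
    exact Finset.prod_eq_zero (Finset.mem_sdiff.2 ⟨Finset.mem_univ i, hiR⟩) (if_pos hiS)

/-- If the family `supp m`, `m ∈ B`, has small weighted count, then some large set contains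
no member of it. -/
theorem exists_large_avoiding {ι β : Type*} [Fintype ι] [DecidableEq ι] [Nonempty ι]
    (B : Finset β) (supp : β → Finset ι) {q : ℝ} (hq0 : 0 < q) (hq1 : q < 1)
    (h : ∑ m ∈ B, q ^ (supp m).card ≤ q / 2) :
    ∃ R : Finset ι, q * Fintype.card ι / 2 ≤ (R.card : ℝ) ∧ ∀ m ∈ B, ¬ supp m ⊆ R := by
  classical
  set N : ℝ := (Fintype.card ι : ℝ) with hN
  have hNpos : 0 < N := by rw [hN]; exact_mod_cast Fintype.card_pos
  set w : Finset ι → ℝ := fun R => q ^ R.card * (1 - q) ^ Rᶜ.card with hw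
  have hwpos : ∀ R, 0 < w R := fun R => by
    have : 0 < 1 - q := by linarith
    simp only [hw]; positivity
  have hcard : ∑ R, w R * (R.card : ℝ) = q * N := by
    have h1 : ∀ R : Finset ι, w R * (R.card : ℝ) = ∑ i, if {i} ⊆ R then w R else 0 := by
      intro R
      simp [Finset.sum_ite_mem, mul_comm]
    simp_rw [h1]
    rw [Finset.sum_comm]
    simp_rw [hw, sum_superset_weight]
    simp [hN, mul_comm]
  have hbad : ∑ R, w R * ((B.filter fun m => supp m ⊆ R).card : ℝ) ≤ q / 2 := by
    refine le_trans (le_of_eq ?_) h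
    have h1 : ∀ R : Finset ι, w R * ((B.filter fun m => supp m ⊆ R).card : ℝ)
        = ∑ m ∈ B, if supp m ⊆ R then w R else 0 := by
      intro R
      rw [← Finset.sum_filter, Finset.sum_const, nsmul_eq_mul, mul_comm]
    simp_rw [h1]
    rw [Finset.sum_comm]
    simp_rw [hw, sum_superset_weight]
  have hone : ∑ R, w R = 1 := by
    have := sum_superset_weight q (∅ : Finset ι)
    simpa using this
  -- The factor `N` is a penalty: since |R| ≤ N, a single member inside `R` makes the difference
  -- nonpositive, so a set reaching the mean is both large and free of members.
  have hle : ∑ R, w R * (q * N / 2)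
      ≤ ∑ R, w R * ((R.card : ℝ) - N * ((B.filter fun m => supp m ⊆ R).card : ℝ)) := by
    have e : ∑ R, w R * ((R.card : ℝ) - N * ((B.filter fun m => supp m ⊆ R).card : ℝ))
        = q * N - N * ∑ R, w R * ((B.filter fun m => supp m ⊆ R).card : ℝ) := by
      rw [← hcard, Finset.mul_sum, ← Finset.sum_sub_distrib]
      exact Finset.sum_congr rfl fun R _ => by ring
    rw [e, ← Finset.sum_mul, hone]
    nlinarith
  obtain ⟨R, -, hR⟩ := Finset.exists_le_of_sum_le Finset.univ_nonempty hle
  have hR' := le_of_mul_le_mul_left hR (hwpos R)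
  have hRN : (R.card : ℝ) ≤ N := by rw [hN]; exact_mod_cast R.card_le_univ
  have hqN : 0 < q * N / 2 := by positivity
  have hempty : (B.filter fun m => supp m ⊆ R).card = 0 := by
    by_contra hne
    have h1 : (1 : ℝ) ≤ ((B.filter fun m => supp m ⊆ R).card : ℝ) := by
      exact_mod_cast Nat.one_le_iff_ne_zero.2 hne
    nlinarith
  refine ⟨R, ?_, fun m hm hmR => ?_⟩
  · rw [hempty] at hR'; simpa using hR'
  · rw [Finset.card_eq_zero] at hempty
    exact Finset.notMem_empty m (hempty ▸ Finset.mem_filter.2 ⟨hm, hmR⟩)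

/-! ### Bounded relations and the deletion argument -/

open Classical in
/-- The exponent vectors `m` with `|m i| ≤ n` and `∏ χ i ^ m i = 1`. -/
noncomputable def boundedRelations {ι Γ : Type*} [Fintype ι] [CommGroup Γ] (χ : ι → Γ) (n : ℕ) :
    Finset (ι → ℤ) :=
  (Fintype.piFinset fun _ => Finset.Icc (-(n : ℤ)) n).filter fun m => ∏ i, χ i ^ m i = 1

theorem mem_boundedRelations {ι Γ : Type*} [Fintype ι] [CommGroup Γ] {χ : ι → Γ} {n : ℕ}
    {m : ι → ℤ} : m ∈ boundedRelations χ n ↔ (∀ i, |m i| ≤ n) ∧ ∏ i, χ i ^ m i = 1 := by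
  simp [boundedRelations, abs_le]

/-- The support of an integer vector. -/
def vecSupport {ι : Type*} [Fintype ι] (m : ι → ℤ) : Finset ι := Finset.univ.filter fun i => m i ≠ 0

theorem mem_vecSupport {ι : Type*} [Fintype ι] {m : ι → ℤ} {i : ι} :
    i ∈ vecSupport m ↔ m i ≠ 0 := by simp [vecSupport]

/-- Deleting the support of a relation of maximal support inside `R` leaves an independent set. -/
theorem exists_independent_of_small_relations {ι Γ : Type*} [Fintype ι] [DecidableEq ι]
    [CommGroup Γ] (χ : ι → Γ) (n : ℕ) (R : Finset ι) (a : ℝ)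
    (hR : ∀ m ∈ boundedRelations χ n, vecSupport m ⊆ R → ((vecSupport m).card : ℝ) ≤ a) :
    ∃ H : Finset ι, (R.card : ℝ) - a ≤ H.card ∧
      ∀ m ∈ boundedRelations χ n, vecSupport m ⊆ H → m = 0 := by
  classical
  have hne : ((boundedRelations χ n).filter fun m => vecSupport m ⊆ R).Nonempty :=
    ⟨0, by simp [mem_boundedRelations, vecSupport]⟩
  obtain ⟨m, hm, hmax⟩ := Finset.exists_max_image _ (fun m => (vecSupport m).card) hne
  obtain ⟨hm1, hm2⟩ := Finset.mem_filter.1 hm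
  refine ⟨R \ vecSupport m, ?_, fun m' hm' hsub => ?_⟩
  · have h1 := hR m hm1 hm2
    have h2 := Finset.card_sdiff_add_card_eq_card hm2
    have h3 : ((R \ vecSupport m).card : ℝ) + (vecSupport m).card = R.card := by exact_mod_cast h2
    linarith
  -- Disjoint supports keep the exponents of `m + m'` bounded by `n`, so a nonzero `m'` would
  -- contradict the maximality of `m`.
  have hdisj : ∀ i, m i = 0 ∨ m' i = 0 := by
    intro i
    by_contra! hcon
    exact (Finset.mem_sdiff.1 (hsub (mem_vecSupport.2 hcon.2))).2 (mem_vecSupport.2 hcon.1)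
  have hsupp : vecSupport (m + m') = vecSupport m ∪ vecSupport m' := by
    ext i
    simp only [mem_vecSupport, Finset.mem_union, Pi.add_apply]
    rcases hdisj i with h | h <;> simp [h]
  rw [mem_boundedRelations] at hm1 hm'
  have hrel : m + m' ∈ boundedRelations χ n := by
    refine mem_boundedRelations.2 ⟨fun i => ?_, ?_⟩
    · rcases hdisj i with h | h
      · simpa [h] using hm'.1 i
      · simpa [h] using hm1.1 i
    · simp [zpow_add, Finset.prod_mul_distrib, hm1.2, hm'.2]
  have hle := hmax (m + m') (Finset.mem_filter.2 ⟨hrel, by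
    rw [hsupp]
    exact Finset.union_subset hm2 (hsub.trans Finset.sdiff_subset)⟩)
  have heq : vecSupport m = vecSupport (m + m') :=
    Finset.eq_of_subset_of_card_le (by rw [hsupp]; exact Finset.subset_union_left) hle
  funext i
  by_contra hi
  have hi' : i ∈ vecSupport m' := mem_vecSupport.2 hi
  have : i ∈ vecSupport m := by rw [heq, hsupp]; exact Finset.mem_union_right _ hi'
  exact (Finset.mem_sdiff.1 (hsub hi')).2 this

/-- Only long relations need to be rare: short ones cost at most half of the random set in the
deletion. -/
theorem exists_independent_of_weighted_count {ι Γ : Type*} [Fintype ι] [Nonempty ι]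
    [CommGroup Γ] (χ : ι → Γ) (n : ℕ) {q : ℝ} (hq0 : 0 < q) (hq1 : q < 1)
    (h : ∑ m ∈ (boundedRelations χ n).filter
      (fun m => q * Fintype.card ι / 4 ≤ ((vecSupport m).card : ℝ)),
      q ^ (vecSupport m).card ≤ q / 2) :
    ∃ H : Finset ι, q * Fintype.card ι / 4 ≤ (H.card : ℝ) ∧
      ∀ m ∈ boundedRelations χ n, vecSupport m ⊆ H → m = 0 := by
  classical
  obtain ⟨R, hRc, hR⟩ := exists_large_avoiding _ vecSupport hq0 hq1 h
  obtain ⟨H, hH, hind⟩ := exists_independent_of_small_relations χ n R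
    (q * Fintype.card ι / 4) (fun m hm hmR => by
      by_contra! hlt
      exact hR m (Finset.mem_filter.2 ⟨hm, hlt.le⟩) hmR)
  exact ⟨H, by linarith, hind⟩

/-! ### Subgaussian and Jensen estimates -/

/-- Subgaussian estimate for real Rademacher sums. -/
theorem sum_signs_exp_le {ι : Type*} [Fintype ι] [DecidableEq ι] (x : ι → ℝ) (hx : ∀ i, |x i| ≤ 1)
    (s : ℝ) :
    ∑ ε ∈ Fintype.piFinset (fun _ : ι => ({1, -1} : Finset ℝ)), Real.exp (s * ∑ i, ε i * x i)
      ≤ 2 ^ Fintype.card ι * Real.exp (s ^ 2 / 2 * Fintype.card ι) := by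
  have h1 : ∀ ε : ι → ℝ, Real.exp (s * ∑ i, ε i * x i) = ∏ i, Real.exp (s * (ε i * x i)) := by
    intro ε; rw [Finset.mul_sum, Real.exp_sum]
  simp_rw [h1]
  rw [← Finset.prod_univ_sum (fun _ : ι => ({1, -1} : Finset ℝ))
    (fun i e => Real.exp (s * (e * x i)))]
  calc _ ≤ ∏ _i : ι, (2 * Real.exp (s ^ 2 / 2)) := by
        refine Finset.prod_le_prod (fun i _ => Finset.sum_nonneg fun _ _ => (Real.exp_pos _).le)
          fun i _ => ?_
        rw [Finset.sum_pair (by norm_num)]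
        have hc := Real.cosh_le_exp_half_sq (s * x i)
        rw [Real.cosh_eq] at hc
        have h2 : Real.exp ((s * x i) ^ 2 / 2) ≤ Real.exp (s ^ 2 / 2) := by
          apply Real.exp_le_exp.2
          have : x i ^ 2 ≤ 1 := (sq_le_one_iff_abs_le_one _).2 (hx i)
          nlinarith [sq_nonneg s]
        have e1 : s * (1 * x i) = s * x i := by ring
        have e2 : s * (-1 * x i) = -(s * x i) := by ring
        rw [e1, e2]
        linarith
    _ = _ := by
        rw [Finset.prod_const, Finset.card_univ, mul_pow, ← Real.exp_nat_mul]
        congr 2; ring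

/-- Subgaussian estimate for complex Rademacher sums. -/
theorem sum_signs_exp_norm_le {ι : Type*} [Fintype ι] [DecidableEq ι] (z : ι → ℂ)
    (hz : ∀ i, ‖z i‖ ≤ 1) {s : ℝ} (hs : 0 ≤ s) :
    ∑ ε ∈ Fintype.piFinset (fun _ : ι => ({1, -1} : Finset ℝ)),
        Real.exp (s * ‖∑ i, (ε i : ℂ) * z i‖)
      ≤ 2 ^ Fintype.card ι * (2 * Real.exp (2 * s ^ 2 * Fintype.card ι)) := by
  -- Real and imaginary parts are separated by 2ab ≤ a² + b², which doubles `s`.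
  have key : ∀ w : ℂ, Real.exp (s * ‖w‖) ≤ (Real.exp (2 * s * w.re) + Real.exp (-(2 * s) * w.re)
      + Real.exp (2 * s * w.im) + Real.exp (-(2 * s) * w.im)) / 2 := by
    intro w
    have a1 : s * ‖w‖ ≤ s * |w.re| + s * |w.im| := by
      rw [← mul_add]; exact mul_le_mul_of_nonneg_left (Complex.norm_le_abs_re_add_abs_im w) hs
    have a2 : Real.exp (s * ‖w‖) ≤ Real.exp (s * |w.re|) * Real.exp (s * |w.im|) := by
      rw [← Real.exp_add]; exact Real.exp_le_exp.2 a1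
    have a3 : ∀ y : ℝ, Real.exp (s * |y|) ^ 2 ≤ Real.exp (2 * s * y) + Real.exp (-(2 * s) * y) := by
      intro y
      rw [← Real.exp_nat_mul]
      rcases abs_cases y with ⟨h, -⟩ | ⟨h, -⟩
      · rw [h]
        have : ((2 : ℕ) : ℝ) * (s * y) = 2 * s * y := by push_cast; ring
        rw [this]
        linarith [Real.exp_pos (-(2 * s) * y)]
      · rw [h]
        have : ((2 : ℕ) : ℝ) * (s * -y) = -(2 * s) * y := by push_cast; ring
        rw [this]
        linarith [Real.exp_pos ((2 * s) * y)]
    nlinarith [a3 w.re, a3 w.im, sq_nonneg (Real.exp (s * |w.re|) - Real.exp (s * |w.im|))]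
  have hre : ∀ i, |(z i).re| ≤ 1 := fun i => (Complex.abs_re_le_norm _).trans (hz i)
  have him : ∀ i, |(z i).im| ≤ 1 := fun i => (Complex.abs_im_le_norm _).trans (hz i)
  refine (Finset.sum_le_sum fun ε _ => key _).trans ?_
  simp only [Complex.re_sum, Complex.im_sum, Complex.re_ofReal_mul, Complex.im_ofReal_mul]
  rw [← Finset.sum_div, Finset.sum_add_distrib, Finset.sum_add_distrib, Finset.sum_add_distrib]
  have b1 := sum_signs_exp_le _ hre (2 * s)
  have b2 := sum_signs_exp_le _ hre (-(2 * s))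
  have b3 := sum_signs_exp_le _ him (2 * s)
  have b4 := sum_signs_exp_le _ him (-(2 * s))
  have e1 : (2 * s) ^ 2 / 2 = 2 * s ^ 2 := by ring
  have e2 : (-(2 * s)) ^ 2 / 2 = 2 * s ^ 2 := by ring
  rw [e1] at b1 b3
  rw [e2] at b2 b4
  linarith

/-- A subprobability-type form of Jensen's inequality for the exponential function. -/
theorem exp_integral_le_one_add {X : Type*} [MeasurableSpace X] (ν : Measure X)
    [IsFiniteMeasure ν] {C : ℝ} (hC : 0 < C) (hν : ν.real Set.univ ≤ C) (g : X → ℝ)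
    (hg : Integrable g ν) (hexp : Integrable (fun y => Real.exp (C * g y)) ν) :
    Real.exp (∫ y, g y ∂ν) ≤ 1 + C⁻¹ * ∫ y, Real.exp (C * g y) ∂ν := by
  rcases eq_or_ne ν 0 with h0 | h0
  · simp [h0]
  have : NeZero ν := ⟨h0⟩
  set M := ν.real Set.univ with hM
  have hMpos : 0 < M := by
    rw [hM, measureReal_def]
    exact ENNReal.toReal_pos (by simpa using h0) (measure_ne_top _ _)
  have hJ := convexOn_exp.map_average_le (μ := ν) (f := fun y => C * g y)
    Real.continuous_exp.continuousOn isClosed_univ (by simp) (hg.const_mul C) hexp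
  rw [average_eq, average_eq, integral_const_mul, ← hM, smul_eq_mul, smul_eq_mul] at hJ
  have hθ : M / C ≤ 1 := (div_le_one hC).2 hν
  -- The missing mass 1 - M/C is placed at 0, where exp is 1; this produces the additive constant.
  have hconv := convexOn_exp.2 (Set.mem_univ (M⁻¹ * (C * ∫ y, g y ∂ν))) (Set.mem_univ (0 : ℝ))
    (show 0 ≤ M / C by positivity) (show 0 ≤ 1 - M / C by linarith) (by ring)
  simp only [smul_eq_mul, mul_zero, add_zero, Real.exp_zero, mul_one] at hconv
  have e1 : M / C * (M⁻¹ * (C * ∫ y, g y ∂ν)) = ∫ y, g y ∂ν := by field_simp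
  rw [e1] at hconv
  have h2 : M / C * Real.exp (M⁻¹ * (C * ∫ y, g y ∂ν))
      ≤ M / C * (M⁻¹ * ∫ y, Real.exp (C * g y) ∂ν) :=
    mul_le_mul_of_nonneg_left hJ (by positivity)
  have e2 : M / C * (M⁻¹ * ∫ y, Real.exp (C * g y) ∂ν) = C⁻¹ * ∫ y, Real.exp (C * g y) ∂ν := by
    field_simp
  rw [e2] at h2
  have : 0 ≤ M / C := by positivity
  linarith

/-- Complex homogeneity of the integral against a complex measure. -/
theorem ComplexMeasure.integral_mul_const_mul {X : Type*} [MeasurableSpace X]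
    (μ : ComplexMeasure X) (c : ℂ) (f : X → ℂ) :
    VectorMeasure.integral μ (fun x => c * f x) (ContinuousLinearMap.mul ℝ ℂ)
      = c * VectorMeasure.integral μ f (ContinuousLinearMap.mul ℝ ℂ) := by
  refine setToFun_smul (𝕜 := ℂ) _ (fun c s x => ?_) c f
  exact mul_assoc c x (μ s)

/-! ### Characters and Rudin's estimate for Sidon sets -/

section Characters

variable {G : Type*} [CommGroup G] [TopologicalSpace G]

/-- Evaluation of characters at `x`, as a homomorphism to `ℂ`. -/
noncomputable def evalHom (x : G) : PontryaginDual G →* ℂ where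
  toFun γ := ((γ x : Circle) : ℂ)
  map_one' := by simp
  map_mul' γ δ := Circle.coe_mul (γ x) (δ x)

theorem evalHom_apply (x : G) (γ : PontryaginDual G) : evalHom x γ = ((γ x : Circle) : ℂ) := rfl

theorem norm_evalHom (x : G) (γ : PontryaginDual G) : ‖evalHom x γ‖ = 1 := Circle.norm_coe _

theorem evalHom_inv (x : G) (γ : PontryaginDual G) :
    evalHom x γ⁻¹ = (starRingEnd ℂ) (evalHom x γ) := Circle.coe_inv_eq_conj (γ x)

theorem evalHom_mul (x y : G) (γ : PontryaginDual G) :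
    evalHom (x * y) γ = evalHom x γ * evalHom y γ := by
  simp [evalHom_apply]

theorem evalHom_inv_left (x : G) (γ : PontryaginDual G) :
    evalHom x⁻¹ γ = (starRingEnd ℂ) (evalHom x γ) := by
  rw [evalHom_apply, evalHom_apply, map_inv, Circle.coe_inv_eq_conj]

theorem evalHom_eq_one_iff (γ : PontryaginDual G) : (∀ x, evalHom x γ = 1) ↔ γ = 1 := by
  refine ⟨fun h => ?_, fun h x => by rw [h, map_one]⟩
  ext x
  exact h x

theorem continuous_evalHom (γ : PontryaginDual G) : Continuous fun x => evalHom x γ :=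
  continuous_subtype_val.comp (map_continuous γ)

theorem norm_signed_sum_le (F : Finset (PontryaginDual G)) (ε : F → ℝ) (hε : ∀ γ, |ε γ| ≤ 1)
    (x : G) : ‖∑ γ : F, (ε γ : ℂ) * evalHom x (γ : PontryaginDual G)‖ ≤ F.card := by
  refine (norm_sum_le _ _).trans ?_
  refine (Finset.sum_le_card_nsmul _ _ 1 fun γ _ => ?_).trans (by simp)
  rw [norm_mul, norm_evalHom, mul_one, Complex.norm_real]
  exact hε γ

variable [MeasurableSpace G]

theorem IsSidon.exists_sign_measure {E : Set (PontryaginDual G)} (hE : IsSidon E) :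
    ∃ C : ℝ, 0 < C ∧ ∀ (F : Finset (PontryaginDual G)), (F : Set (PontryaginDual G)) ⊆ E →
      ∀ ε : F → ℝ, (∀ γ, |ε γ| ≤ 1) → ∃ μ : ComplexMeasure G,
        (∀ γ : F, fourierStieltjes μ γ = ε γ) ∧ μ.variation Set.univ ≤ ENNReal.ofReal C := by
  classical
  obtain ⟨C, hC⟩ := hE
  -- The Sidon constant may be nonpositive, and Jensen's inequality later divides by it. The signs
  -- are extended by 0 to `E`.
  refine ⟨max C 1, by positivity, fun F hF ε hε => ?_⟩
  have hb : ∀ γ : E, ‖(if h : (γ : PontryaginDual G) ∈ F then (ε ⟨γ, h⟩ : ℂ) else 0)‖ ≤ 1 := by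
    intro γ
    split_ifs
    · simpa using hε _
    · simp
  obtain ⟨μ, -, hμ, hvar⟩ := hC
    (fun γ => if h : (γ : PontryaginDual G) ∈ F then (ε ⟨γ, h⟩ : ℂ) else 0)
    ⟨1, by rintro _ ⟨γ, rfl⟩; exact hb γ⟩
  refine ⟨μ, fun γ => by simpa using hμ ⟨γ, hF γ.2⟩, hvar.trans (ENNReal.ofReal_le_ofReal ?_)⟩
  have h1 := Real.iSup_le hb zero_le_one
  have h0 : 0 ≤ ⨆ γ : E, ‖(if h : (γ : PontryaginDual G) ∈ F then (ε ⟨γ, h⟩ : ℂ) else 0)‖ :=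
    Real.iSup_nonneg fun _ => norm_nonneg _
  calc _ ≤ max C 1 * _ := mul_le_mul_of_nonneg_right (le_max_left _ _) h0
    _ ≤ max C 1 * 1 := mul_le_mul_of_nonneg_left h1 (by positivity)
    _ = _ := mul_one _

variable [BorelSpace G]

theorem measurable_evalHom (γ : PontryaginDual G) : Measurable fun x => evalHom x γ :=
  (continuous_evalHom γ).measurable

theorem integrable_evalHom (m : Measure G) [IsFiniteMeasure m] (γ : PontryaginDual G) :
    Integrable (fun x => evalHom x γ) m :=
  .of_bound (measurable_evalHom γ).aestronglyMeasurable 1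
    (.of_forall fun x => (norm_evalHom x γ).le)

/-- If the signs `ε` are interpolated by a complex measure, then `∑ γ` is the convolution of that
measure with the signed sum `∑ ε γ`. -/
theorem norm_sum_evalHom_le (F : Finset (PontryaginDual G)) (ε : F → ℝ) (hε : ∀ γ, ε γ * ε γ = 1)
    (μ : ComplexMeasure G) [IsFiniteMeasure μ.variation]
    (hμ : ∀ γ : F, fourierStieltjes μ γ = ε γ) (x : G) :
    ‖∑ γ ∈ F, evalHom x γ‖
      ≤ ∫ y, ‖∑ γ : F, (ε γ : ℂ) * evalHom (y⁻¹ * x) (γ : PontryaginDual G)‖ ∂μ.variation := by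
  have h1 : ∑ γ ∈ F, evalHom x γ = VectorMeasure.integral μ
      (fun y => ∑ γ : F, (ε γ : ℂ) * evalHom (y⁻¹ * x) (γ : PontryaginDual G))
      (ContinuousLinearMap.mul ℝ ℂ) := by
    have hterm : ∀ (γ : F) (y : G), (ε γ : ℂ) * evalHom (y⁻¹ * x) (γ : PontryaginDual G)
        = (ε γ * evalHom x (γ : PontryaginDual G)) *
          (starRingEnd ℂ) (evalHom y (γ : PontryaginDual G)) := by
      intro γ y
      rw [evalHom_mul, evalHom_inv_left]; ring
    simp_rw [hterm]
    rw [VectorMeasure.integral_finsetSum, ← Finset.sum_coe_sort]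
    · refine Finset.sum_congr rfl fun γ _ => ?_
      rw [ComplexMeasure.integral_mul_const_mul]
      have := hμ γ
      unfold fourierStieltjes at this
      erw [this]
      have h2 : ((ε γ : ℂ)) * ε γ = 1 := by exact_mod_cast hε γ
      linear_combination (-evalHom x (γ : PontryaginDual G)) * h2
    · intro γ _
      refine Integrable.const_mul ?_ _
      simp_rw [← evalHom_inv]
      exact integrable_evalHom _ _
  rw [h1]
  refine VectorMeasure.norm_integral_le_integral_norm.trans ?_
  rw [ContinuousLinearMap.opNorm_mul, one_mul]

variable [IsTopologicalGroup G]

/-- Orthogonality of characters. -/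
theorem integral_evalHom (m : Measure G) [IsProbabilityMeasure m] [m.IsMulLeftInvariant]
    (γ : PontryaginDual G) [Decidable (γ = 1)] :
    ∫ x, evalHom x γ ∂m = if γ = 1 then 1 else 0 := by
  split_ifs with h
  · simp [h]
  · rw [← evalHom_eq_one_iff] at h
    push Not at h
    obtain ⟨x₀, hx₀⟩ := h
    have h1 := integral_mul_left_eq_self (μ := m) (fun x => evalHom x γ) x₀
    simp_rw [evalHom_mul, integral_const_mul] at h1
    have h2 : (evalHom x₀ γ - 1) * ∫ x, evalHom x γ ∂m = 0 := by rw [sub_mul, h1]; ring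
    exact (mul_eq_zero.1 h2).resolve_left (sub_ne_zero.2 hx₀)

/-- If `k` is dominated by the convolution of `f ≥ 0` with a measure of mass at most `C`, then
the exponential integral of `k` is controlled by that of `C * f`. -/
theorem integral_exp_le_of_le_convolution (m : Measure G) [IsProbabilityMeasure m]
    [m.IsMulLeftInvariant] (ν : Measure G) [IsFiniteMeasure ν] {C b : ℝ} (hC : 0 < C)
    (hν : ν.real Set.univ ≤ C) (f k : G → ℝ) (hf0 : ∀ x, 0 ≤ f x) (hfb : ∀ x, f x ≤ b)
    (hfm : Measurable fun p : G × G => f (p.2⁻¹ * p.1))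
    (hk : ∀ x, k x ≤ ∫ y, f (y⁻¹ * x) ∂ν) :
    ∫ x, Real.exp (k x) ∂m ≤ 1 + ∫ x, Real.exp (C * f x) ∂m := by
  have hbound : ∀ z, ‖Real.exp (C * f z)‖ ≤ Real.exp (C * b) := by
    intro z
    rw [Real.norm_of_nonneg (Real.exp_pos _).le]
    exact Real.exp_le_exp.2 (mul_le_mul_of_nonneg_left (hfb z) hC.le)
  have hprod : Integrable (Function.uncurry fun x y => Real.exp (C * f (y⁻¹ * x)))
      (m.prod ν) :=
    .of_bound (hfm.const_mul C).exp.aestronglyMeasurable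
      (Real.exp (C * b)) (.of_forall fun p => hbound _)
  have hslice : ∀ x, Measurable fun y => f (y⁻¹ * x) := fun x => hfm.comp measurable_prodMk_left
  have hleft : Integrable (fun x => C⁻¹ * ∫ y, Real.exp (C * f (y⁻¹ * x)) ∂ν) m :=
    hprod.integral_prod_left.const_mul _
  have hpt : ∀ x, Real.exp (k x) ≤ 1 + C⁻¹ * ∫ y, Real.exp (C * f (y⁻¹ * x)) ∂ν := by
    intro x
    refine le_trans (Real.exp_le_exp.2 (hk x)) (exp_integral_le_one_add ν hC hν
      (fun y => f (y⁻¹ * x)) ?_ ?_)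
    · refine .of_bound (hslice x).aestronglyMeasurable b (.of_forall fun y => ?_)
      rw [Real.norm_of_nonneg (hf0 _)]
      exact hfb _
    · exact .of_bound ((hslice x).const_mul C).exp.aestronglyMeasurable
        (Real.exp (C * b)) (.of_forall fun y => hbound _)
  -- Invariance removes `y`, so the outer integral contributes only the mass of `ν`, which `C⁻¹`
  -- absorbs.
  have htrans : ∀ y : G, ∫ x, Real.exp (C * f (y⁻¹ * x)) ∂m = ∫ x, Real.exp (C * f x) ∂m :=
    fun y => integral_mul_left_eq_self (μ := m) (fun x => Real.exp (C * f x)) y⁻¹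
  calc ∫ x, Real.exp (k x) ∂m
      ≤ ∫ x, (1 + C⁻¹ * ∫ y, Real.exp (C * f (y⁻¹ * x)) ∂ν) ∂m :=
        integral_mono_of_nonneg (.of_forall fun x => (Real.exp_pos _).le)
          ((integrable_const _).add hleft) (.of_forall hpt)
    _ = 1 + C⁻¹ * ∫ y, ∫ x, Real.exp (C * f (y⁻¹ * x)) ∂m ∂ν := by
        rw [integral_add (integrable_const _) hleft, integral_const_mul,
          integral_integral_swap hprod]
        simp
    _ = 1 + C⁻¹ * (ν.real Set.univ * ∫ x, Real.exp (C * f x) ∂m) := by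
        simp_rw [htrans]
        rw [integral_const, smul_eq_mul]
    _ ≤ 1 + C⁻¹ * (C * ∫ x, Real.exp (C * f x) ∂m) := by
        have : 0 ≤ ∫ x, Real.exp (C * f x) ∂m := integral_nonneg fun _ => (Real.exp_pos _).le
        gcongr
    _ = _ := by rw [inv_mul_cancel_left₀ hC.ne']

theorem integral_exp_sum_le_signed (m : Measure G) [IsProbabilityMeasure m] [m.IsMulLeftInvariant]
    {C : ℝ} (hC : 0 < C) (F : Finset (PontryaginDual G)) (ε : F → ℝ)
    (hε : ∀ γ, ε γ * ε γ = 1) (μ : ComplexMeasure G)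
    (hμ : ∀ γ : F, fourierStieltjes μ γ = ε γ) (hvar : μ.variation Set.univ ≤ ENNReal.ofReal C)
    {t : ℝ} (ht : 0 ≤ t) :
    ∫ x, Real.exp (t * ‖∑ γ ∈ F, evalHom x γ‖) ∂m
      ≤ 1 + ∫ x, Real.exp (C * t * ‖∑ γ : F, (ε γ : ℂ) * evalHom x (γ : PontryaginDual G)‖) ∂m := by
  have : IsFiniteMeasure μ.variation := ⟨hvar.trans_lt ENNReal.ofReal_lt_top⟩
  have hε1 : ∀ γ, |ε γ| ≤ 1 := fun γ => by
    rw [← sq_le_one_iff_abs_le_one, sq, hε]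
  simp_rw [mul_assoc C t]
  refine integral_exp_le_of_le_convolution m μ.variation (b := t * F.card) hC
    (ENNReal.toReal_le_of_le_ofReal hC.le hvar)
    (fun x => t * ‖∑ γ : F, (ε γ : ℂ) * evalHom x (γ : PontryaginDual G)‖) _
    (fun x => by positivity)
    (fun x => mul_le_mul_of_nonneg_left (norm_signed_sum_le F ε hε1 x) ht) ?_ (fun x => ?_)
  · simp only [evalHom_mul, evalHom_inv_left, ← evalHom_inv]
    refine (Finset.measurable_fun_sum _ fun γ _ => ?_).norm.const_mul t
    exact (((measurable_evalHom _).comp measurable_snd).mul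
      ((measurable_evalHom _).comp measurable_fst)).const_mul _
  · rw [integral_const_mul]
    exact mul_le_mul_of_nonneg_left (norm_sum_evalHom_le F ε hε μ hμ x) ht

/-- Rudin's subgaussian estimate for Sidon sets. -/
theorem IsSidon.exists_integral_exp_le (m : Measure G) [IsProbabilityMeasure m]
    [m.IsMulLeftInvariant] {E : Set (PontryaginDual G)} (hE : IsSidon E) :
    ∃ C : ℝ, ∀ (F : Finset (PontryaginDual G)), (F : Set (PontryaginDual G)) ⊆ E →
      ∀ t : ℝ, 0 ≤ t → ∫ x, Real.exp (t * ‖∑ γ ∈ F, evalHom x γ‖) ∂m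
        ≤ 3 * Real.exp (C * t ^ 2 * F.card) := by
  classical
  obtain ⟨C, hC, hmeas⟩ := hE.exists_sign_measure
  refine ⟨2 * C ^ 2, fun F hF t ht => ?_⟩
  set S := Fintype.piFinset (fun _ : F => ({1, -1} : Finset ℝ)) with hS
  have hScard : (S.card : ℝ) = 2 ^ F.card := by
    rw [hS, Fintype.card_piFinset]
    simp [Finset.card_pair (show (1 : ℝ) ≠ -1 by norm_num)]
  have hsign : ∀ ε ∈ S, ∀ γ, ε γ * ε γ = 1 := by
    intro ε hε γ
    have := Fintype.mem_piFinset.1 hε γ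
    simp only [Finset.mem_insert, Finset.mem_singleton] at this
    rcases this with h | h <;> rw [h] <;> norm_num
  have habs : ∀ ε ∈ S, ∀ γ, |ε γ| ≤ 1 := fun ε hε γ => by
    rw [← sq_le_one_iff_abs_le_one, sq, hsign ε hε]
  set I := ∫ x, Real.exp (t * ‖∑ γ ∈ F, evalHom x γ‖) ∂m with hI
  have hstep : ∀ ε ∈ S, I ≤ 1 + ∫ x, Real.exp (C * t *
      ‖∑ γ : F, (ε γ : ℂ) * evalHom x (γ : PontryaginDual G)‖) ∂m := by
    intro ε hε
    obtain ⟨μ, hμ, hvar⟩ := hmeas F hF ε (habs ε hε)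
    exact integral_exp_sum_le_signed m hC F ε (hsign ε hε) μ hμ hvar ht
  -- `I` does not involve the signs, so the bound may be averaged over all of them.
  have hsum := Finset.sum_le_sum hstep
  rw [Finset.sum_const, nsmul_eq_mul, Finset.sum_add_distrib, Finset.sum_const, nsmul_eq_mul,
    mul_one, hScard, ← integral_finsetSum] at hsum
  · have hle : ∫ x, ∑ ε ∈ S, Real.exp (C * t *
        ‖∑ γ : F, (ε γ : ℂ) * evalHom x (γ : PontryaginDual G)‖) ∂m
        ≤ 2 ^ F.card * (2 * Real.exp (2 * (C * t) ^ 2 * F.card)) := by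
      have := integral_mono_of_nonneg (μ := m) (.of_forall fun x => Finset.sum_nonneg
        fun ε _ => (Real.exp_pos _).le) (integrable_const _) (.of_forall fun x =>
        sum_signs_exp_norm_le (fun γ : F => evalHom x (γ : PontryaginDual G))
          (fun γ => (norm_evalHom x _).le) (s := C * t) (by positivity))
      simpa using this
    have h2 : (0 : ℝ) < 2 ^ F.card := by positivity
    have h3 : I ≤ 1 + 2 * Real.exp (2 * (C * t) ^ 2 * F.card) := by
      refine le_of_mul_le_mul_left ?_ h2
      linarith
    have h4 : 1 ≤ Real.exp (2 * (C * t) ^ 2 * F.card) := Real.one_le_exp (by positivity)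
    have e : 2 * C ^ 2 * t ^ 2 * (F.card : ℝ) = 2 * (C * t) ^ 2 * F.card := by ring
    rw [e]
    linarith
  · intro ε hε
    refine .of_bound (Measurable.aestronglyMeasurable ?_) (Real.exp (C * t * F.card))
      (.of_forall fun x => ?_)
    · refine ((Finset.measurable_fun_sum _ fun γ _ => ?_).norm.const_mul _).exp
      exact (measurable_evalHom _).const_mul _
    · rw [Real.norm_of_nonneg (Real.exp_pos _).le]
      gcongr
      exact norm_signed_sum_le F ε (habs ε hε) x

end Characters

/-! ### Weighted relation counts through Riesz-type products -/

/-- Keeping `u.re` instead of `‖u‖` to first order preserves cancellation when the factors are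
multiplied; the error is quadratic. -/
theorem norm_one_add_le_exp (u : ℂ) : ‖1 + u‖ ≤ Real.exp (u.re + ‖u‖ ^ 2 / 2) := by
  have h1 : ‖1 + u‖ ^ 2 = 1 + 2 * u.re + ‖u‖ ^ 2 := by
    rw [← Complex.normSq_eq_norm_sq, ← Complex.normSq_eq_norm_sq, Complex.normSq_apply,
      Complex.normSq_apply]
    simp
    ring
  have h2 : Real.exp (u.re + ‖u‖ ^ 2 / 2) ^ 2 = Real.exp (2 * u.re + ‖u‖ ^ 2) := by
    rw [← Real.exp_nat_mul]; congr 1; push_cast; ring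
  refine le_of_sq_le_sq ?_ (Real.exp_pos _).le
  rw [h1, h2]
  linarith [Real.add_one_le_exp (2 * u.re + ‖u‖ ^ 2)]

/-- The sum is at most |J| times its largest term. This decouples the different powers `j` without
Hölder's inequality. -/
theorem exp_sum_le_sum_exp {κ : Type*} {J : Finset κ} (hJ : J.Nonempty) (S : κ → ℝ) :
    Real.exp (∑ j ∈ J, S j) ≤ ∑ j ∈ J, Real.exp (J.card * S j) := by
  obtain ⟨j, hj, hmax⟩ := Finset.exists_max_image J S hJ
  refine le_trans (Real.exp_le_exp.2 ?_) (Finset.single_le_sum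
    (f := fun j => Real.exp (J.card * S j)) (fun _ _ => (Real.exp_pos _).le) hj)
  simpa using Finset.sum_le_card_nsmul J S _ hmax

section Characters

variable {G : Type*} [CommGroup G] [TopologicalSpace G]

theorem norm_prod_one_add_le {ι κ : Type*} [Fintype ι] {J : Finset κ} (hJ : J.Nonempty)
    {p : ℝ} (hp : 0 ≤ p) (z : ι → κ → ℂ) (hz : ∀ i j, ‖z i j‖ ≤ 1) :
    ‖∏ i, (1 + p * ∑ j ∈ J, z i j)‖ ≤ Real.exp ((p * J.card) ^ 2 / 2 * Fintype.card ι) *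
      ∑ j ∈ J, Real.exp (J.card * p * ‖∑ i, z i j‖) := by
  have hu : ∀ i, ‖(p : ℂ) * ∑ j ∈ J, z i j‖ ≤ p * J.card := by
    intro i
    rw [norm_mul, Complex.norm_of_nonneg hp]
    refine mul_le_mul_of_nonneg_left ((norm_sum_le _ _).trans ?_) hp
    simpa using Finset.sum_le_card_nsmul J _ 1 fun j _ => hz i j
  have hre : ∑ i, ((p : ℂ) * ∑ j ∈ J, z i j).re ≤ ∑ j ∈ J, p * ‖∑ i, z i j‖ := by
    rw [← Complex.re_sum, ← Finset.mul_sum, Finset.sum_comm, Finset.mul_sum, Complex.re_sum]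
    refine Finset.sum_le_sum fun j _ => ?_
    rw [Complex.re_ofReal_mul]
    exact mul_le_mul_of_nonneg_left (Complex.re_le_norm _) hp
  calc _ ≤ ∏ i, Real.exp (((p : ℂ) * ∑ j ∈ J, z i j).re + (p * J.card) ^ 2 / 2) := by
        rw [norm_prod]
        refine Finset.prod_le_prod (fun _ _ => norm_nonneg _) fun i _ =>
          (norm_one_add_le_exp _).trans (Real.exp_le_exp.2 ?_)
        have := pow_le_pow_left₀ (norm_nonneg _) (hu i) 2
        linarith
    _ = Real.exp ((p * J.card) ^ 2 / 2 * Fintype.card ι) *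
          Real.exp (∑ i, ((p : ℂ) * ∑ j ∈ J, z i j).re) := by
        rw [← Real.exp_sum, ← Real.exp_add, Finset.sum_add_distrib, Finset.sum_const,
          Finset.card_univ, nsmul_eq_mul]
        congr 1; ring
    _ ≤ _ := by
        refine mul_le_mul_of_nonneg_left ?_ (Real.exp_pos _).le
        refine (Real.exp_le_exp.2 hre).trans ?_
        simpa only [mul_assoc] using exp_sum_le_sum_exp hJ fun j => p * ‖∑ i, z i j‖

/-- Negative powers are conjugates of positive ones, the only powers covered by the Sidon
hypothesis. -/
theorem norm_sum_evalHom_zpow {ι : Type*} (s : Finset ι) (χ : ι → PontryaginDual G) (x : G)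
    (j : ℤ) : ‖∑ i ∈ s, evalHom x (χ i ^ j)‖ = ‖∑ i ∈ s, evalHom x (χ i ^ j.natAbs)‖ := by
  rcases Int.natAbs_eq j with h | h
  · conv_lhs => rw [h]
    simp only [zpow_natCast]
  · conv_lhs => rw [h]
    simp only [zpow_neg, zpow_natCast, evalHom_inv]
    rw [← map_sum, RCLike.norm_conj]

variable [IsTopologicalGroup G] [MeasurableSpace G] [BorelSpace G]

/-- The weighted number of relations as an integral. -/
theorem sum_relations_eq_integral (m : Measure G) [IsProbabilityMeasure m] [m.IsMulLeftInvariant]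
    {ι : Type*} [Fintype ι] (χ : ι → PontryaginDual G) (n : ℕ) (p : ℝ) :
    ((∑ r ∈ boundedRelations χ n, p ^ (vecSupport r).card : ℝ) : ℂ) =
      ∫ x, ∏ i, (1 + p * ∑ j ∈ (Finset.Icc (-(n : ℤ)) n).erase 0, evalHom x (χ i ^ j)) ∂m := by
  classical
  -- Weight `p` on nonzero exponents makes the expansion over exponent vectors record the support
  -- size.
  set W : ℤ → ℂ := fun j => if j = 0 then 1 else p with hW
  have hfac : ∀ (x : G) (i : ι),
      1 + p * ∑ j ∈ (Finset.Icc (-(n : ℤ)) n).erase 0, evalHom x (χ i ^ j)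
        = ∑ j ∈ Finset.Icc (-(n : ℤ)) n, W j * evalHom x (χ i ^ j) := by
    intro x i
    rw [← Finset.add_sum_erase _ _ (show (0 : ℤ) ∈ Finset.Icc (-(n : ℤ)) n by simp),
      Finset.mul_sum]
    congr 1
    · simp [hW]
    · refine Finset.sum_congr rfl fun j hj => ?_
      rw [hW]
      simp only [if_neg (Finset.ne_of_mem_erase hj)]
  have hWprod : ∀ r : ι → ℤ, ∏ i, W (r i) = (p : ℂ) ^ (vecSupport r).card := by
    intro r
    simp only [hW, Finset.prod_ite, Finset.prod_const_one, one_mul, Finset.prod_const, vecSupport]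
  simp_rw [hfac, Finset.prod_univ_sum, Finset.prod_mul_distrib, hWprod, ← map_prod]
  rw [integral_finsetSum _ fun r _ => (integrable_evalHom m _).const_mul _]
  simp_rw [integral_const_mul, integral_evalHom]
  rw [boundedRelations, Finset.sum_filter]
  push_cast
  refine Finset.sum_congr rfl fun r _ => ?_
  split_ifs <;> simp

/-- Exponential integrability of the power sums bounds the weighted number of relations. -/
theorem sum_relations_le (m : Measure G) [IsProbabilityMeasure m] [m.IsMulLeftInvariant]
    {ι : Type*} [Fintype ι] (χ : ι → PontryaginDual G) {n : ℕ} (hn : 1 ≤ n) {p K : ℝ} (hp : 0 ≤ p)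
    (hK : ∀ j ∈ (Finset.Icc (-(n : ℤ)) n).erase 0,
      ∫ x, Real.exp (2 * n * p * ‖∑ i, evalHom x (χ i ^ j)‖) ∂m ≤ K) :
    ∑ r ∈ boundedRelations χ n, p ^ (vecSupport r).card
      ≤ Real.exp (2 * n ^ 2 * p ^ 2 * Fintype.card ι) * (2 * n * K) := by
  set J := (Finset.Icc (-(n : ℤ)) n).erase 0 with hJ
  have hJc : (J.card : ℝ) = 2 * n := by
    have : J.card = 2 * n := by
      rw [hJ, Finset.card_erase_of_mem (by simp), Int.card_Icc]
      omega
    rw [this]; push_cast; ring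
  have hJne : J.Nonempty := ⟨1, by simp [hJ]; omega⟩
  have hpt := fun x : G => norm_prod_one_add_le hJne hp (fun i j => evalHom x (χ i ^ j))
    fun i j => (norm_evalHom x _).le
  have hint : ∀ j ∈ J, Integrable
      (fun x => Real.exp (J.card * p * ‖∑ i, evalHom x (χ i ^ j)‖)) m := by
    intro j _
    refine .of_bound (Measurable.aestronglyMeasurable ?_)
      (Real.exp (J.card * p * Fintype.card ι)) (.of_forall fun x => ?_)
    · exact ((Finset.measurable_fun_sum _ fun i _ => measurable_evalHom _).norm.const_mul _).exp
    · rw [Real.norm_of_nonneg (Real.exp_pos _).le]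
      gcongr
      refine (norm_sum_le _ _).trans ?_
      simp [norm_evalHom]
  calc ∑ r ∈ boundedRelations χ n, p ^ (vecSupport r).card
      ≤ ‖((∑ r ∈ boundedRelations χ n, p ^ (vecSupport r).card : ℝ) : ℂ)‖ := by
        rw [Complex.norm_real]; exact Real.le_norm_self _
    _ ≤ ∫ x, Real.exp ((p * J.card) ^ 2 / 2 * Fintype.card ι) *
          ∑ j ∈ J, Real.exp (J.card * p * ‖∑ i, evalHom x (χ i ^ j)‖) ∂m := by
        rw [sum_relations_eq_integral m]
        exact norm_integral_le_of_norm_le ((integrable_finsetSum _ hint).const_mul _)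
          (.of_forall hpt)
    _ = Real.exp (2 * n ^ 2 * p ^ 2 * Fintype.card ι) *
          ∑ j ∈ J, ∫ x, Real.exp (2 * n * p * ‖∑ i, evalHom x (χ i ^ j)‖) ∂m := by
        rw [integral_const_mul, integral_finsetSum _ hint, hJc]
        congr 3; ring
    _ ≤ _ := by
        refine mul_le_mul_of_nonneg_left ?_ (Real.exp_pos _).le
        refine (Finset.sum_le_card_nsmul J _ K hK).trans ?_
        rw [nsmul_eq_mul, hJc]

/-- If all power sets `E_k`, `1 ≤ k ≤ n`, are Sidon, finite subsets of `E` satisfy few relations. -/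
theorem exists_sum_relations_le (m : Measure G) [IsProbabilityMeasure m] [m.IsMulLeftInvariant]
    {n : ℕ} (hn : 1 ≤ n) (hΓ : ∀ γ : PontryaginDual G, γ ≠ 1 → IsOfFinOrder γ → n < orderOf γ)
    (E : Set (PontryaginDual G))
    (hSidon : ∀ k : ℕ, 1 ≤ k → k ≤ n → IsSidon ((fun γ : PontryaginDual G => γ ^ k) '' E)) :
    ∃ A D : ℝ, 0 < A ∧ 0 < D ∧ ∀ F : Finset (PontryaginDual G),
      (F : Set (PontryaginDual G)) ⊆ E → ∀ p : ℝ, 0 ≤ p →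
        ∑ r ∈ boundedRelations (fun γ : F => (γ : PontryaginDual G)) n, p ^ (vecSupport r).card
          ≤ A * Real.exp (D * p ^ 2 * F.card) := by
  classical
  have hC : ∀ k : ℕ, ∃ C : ℝ, 1 ≤ k → k ≤ n → ∀ F : Finset (PontryaginDual G),
      (F : Set (PontryaginDual G)) ⊆ (fun γ : PontryaginDual G => γ ^ k) '' E →
      ∀ t : ℝ, 0 ≤ t → ∫ x, Real.exp (t * ‖∑ γ ∈ F, evalHom x γ‖) ∂m
        ≤ 3 * Real.exp (C * t ^ 2 * F.card) := by
    intro k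
    by_cases hk : 1 ≤ k ∧ k ≤ n
    · obtain ⟨C, hC⟩ := (hSidon k hk.1 hk.2).exists_integral_exp_le m
      exact ⟨C, fun _ _ => hC⟩
    · exact ⟨0, fun h1 h2 => absurd ⟨h1, h2⟩ hk⟩
  choose C hC using hC
  set M : ℝ := ∑ k ∈ Finset.Icc 1 n, |C k| with hM
  have hM0 : 0 ≤ M := Finset.sum_nonneg fun _ _ => abs_nonneg _
  have hn0 : (0 : ℝ) < n := by exact_mod_cast hn
  -- 6n is 2n exponents times Rudin's 3; `D` adds the quadratic error to Rudin's exponent at t =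
  -- 2np.
  refine ⟨6 * n, 2 * n ^ 2 + M * (2 * n) ^ 2, by positivity, by positivity, fun F hF p hp => ?_⟩
  -- If γ ^ k = δ ^ k, then γ / δ has order at most `n`, hence is trivial.
  have hinj : ∀ k : ℕ, 1 ≤ k → k ≤ n → Function.Injective fun γ : PontryaginDual G => γ ^ k := by
    intro k hk1 hkn γ δ hγδ
    have h1 : (γ / δ) ^ k = 1 := by rw [div_pow, div_eq_one]; exact hγδ
    by_contra hne
    have h2 := hΓ (γ / δ) (fun h => hne (div_eq_one.1 h))
      (isOfFinOrder_iff_pow_eq_one.2 ⟨k, hk1, h1⟩)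
    exact absurd (orderOf_le_of_pow_eq_one hk1 h1) (by omega)
  have hbound : ∀ j ∈ (Finset.Icc (-(n : ℤ)) n).erase 0,
      ∫ x, Real.exp (2 * n * p * ‖∑ γ : F, evalHom x ((γ : PontryaginDual G) ^ j)‖) ∂m
        ≤ 3 * Real.exp (M * (2 * n * p) ^ 2 * F.card) := by
    intro j hj
    rw [Finset.mem_erase, Finset.mem_Icc] at hj
    have hk1 : 1 ≤ j.natAbs := by omega
    have hkn : j.natAbs ≤ n := by omega
    have h1 := hC j.natAbs hk1 hkn (F.image fun γ => γ ^ j.natAbs)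
      (by rw [Finset.coe_image]; exact Set.image_mono hF) (2 * n * p) (by positivity)
    simp_rw [Finset.sum_image ((hinj _ hk1 hkn).injOn),
      Finset.card_image_of_injective _ (hinj _ hk1 hkn)] at h1
    simp_rw [norm_sum_evalHom_zpow,
      fun x : G => Finset.sum_coe_sort F (fun γ => evalHom x (γ ^ j.natAbs))]
    refine h1.trans ?_
    gcongr
    refine (le_abs_self _).trans ?_
    exact Finset.single_le_sum (f := fun k => |C k|) (fun _ _ => abs_nonneg _)
      (Finset.mem_Icc.2 ⟨hk1, hkn⟩)
  refine (sum_relations_le m _ hn hp hbound).trans (le_of_eq ?_)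
  rw [Fintype.card_coe]
  have e : (2 * (n : ℝ) ^ 2 + M * (2 * n) ^ 2) * p ^ 2 * F.card
      = 2 * n ^ 2 * p ^ 2 * F.card + M * (2 * n * p) ^ 2 * F.card := by ring
  rw [e, Real.exp_add]
  ring

end Characters

/-! ### Choice of density and conclusion -/

/-- A choice of density for the random subset. -/
theorem exists_density {A D : ℝ} (hA : 0 < A) (hD : 0 < D) :
    ∃ q N₀ : ℝ, 0 < q ∧ q < 1 ∧ 0 < N₀ ∧ ∀ N : ℝ, N₀ ≤ N →
      Real.exp (-(q * N / 4)) * (A * Real.exp (D * (Real.exp 1 * q) ^ 2 * N)) ≤ q / 2 := by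
  set B := D * Real.exp 1 ^ 2 with hB
  have hBpos : 0 < B := by positivity
  -- This makes Bq ≤ 1/8, so the quadratic loss uses only half of the gain qN/4; the threshold
  -- 16A/q² lets the other half absorb `A`.
  set q := 1 / (8 * B + 2) with hq
  have hq0 : 0 < q := by positivity
  have hq1 : q < 1 := by rw [hq, div_lt_one (by positivity)]; linarith
  have hBq : B * q ≤ 1 / 8 := by
    rw [hq, mul_one_div, div_le_div_iff₀ (by positivity) (by norm_num)]; linarith
  refine ⟨q, 16 * A / q ^ 2, hq0, hq1, by positivity, fun N hN => ?_⟩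
  have hNpos : 0 < N := lt_of_lt_of_le (by positivity) hN
  have h1 : D * (Real.exp 1 * q) ^ 2 * N ≤ q * N / 8 := by
    have e : D * (Real.exp 1 * q) ^ 2 * N = B * q * (q * N) := by rw [hB]; ring
    rw [e]
    have := mul_le_mul_of_nonneg_right hBq (mul_pos hq0 hNpos).le
    linarith
  have h2 : 2 * A / q ≤ q * N / 8 := by
    rw [div_le_iff₀ (by positivity)] at hN
    rw [div_le_div_iff₀ hq0 (by norm_num)]
    linarith
  have h3 : A ≤ q / 2 * Real.exp (q * N / 8) := by
    have h4 : 2 * A / q ≤ Real.exp (q * N / 8) := by linarith [Real.add_one_le_exp (q * N / 8)]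
    rw [div_le_iff₀ hq0] at h4
    linarith
  calc _ ≤ Real.exp (-(q * N / 4)) * (A * Real.exp (q * N / 8)) := by gcongr
    _ = A * Real.exp (-(q * N / 8)) := by
        rw [mul_left_comm, ← Real.exp_add]; congr 2; ring
    _ ≤ q / 2 * Real.exp (q * N / 8) * Real.exp (-(q * N / 8)) := by gcongr
    _ = q / 2 := by rw [mul_assoc, ← Real.exp_add, add_neg_cancel, Real.exp_zero, mul_one]

/-- A Chernoff tilt: on supports of size at least `a`, 1 ≤ exp(|supp r| - a). -/
theorem sum_long_relations_le {ι : Type*} [Fintype ι] (B : Finset (ι → ℤ)) {q a : ℝ}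
    (hq : 0 < q) :
    ∑ r ∈ B.filter (fun r => a ≤ ((vecSupport r).card : ℝ)), q ^ (vecSupport r).card
      ≤ Real.exp (-a) * ∑ r ∈ B, (Real.exp 1 * q) ^ (vecSupport r).card := by
  rw [Finset.mul_sum]
  refine (Finset.sum_le_sum fun r hr => ?_).trans (Finset.sum_le_sum_of_subset_of_nonneg
    (Finset.filter_subset _ B) fun r _ _ => by positivity)
  have ha := (Finset.mem_filter.1 hr).2
  rw [mul_pow, ← mul_assoc, ← Real.exp_nat_mul, ← Real.exp_add]
  refine le_mul_of_one_le_left (by positivity) (Real.one_le_exp ?_)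
  linarith

/-- Exponents are extended by zero from `s` to `F`. -/
theorem isDegreeIndependent_map_subtype {Γ : Type*} [CommGroup Γ] (n : ℕ) {F : Finset Γ}
    (H : Finset F)
    (hH : ∀ r ∈ boundedRelations (fun γ : F => (γ : Γ)) n, vecSupport r ⊆ H → r = 0) :
    IsDegreeIndependent n (H.map (Function.Embedding.subtype _) : Set Γ) := by
  classical
  intro s m hs hm hprod γ hγ
  have hsH : ∀ δ (hδ : δ ∈ s), ∃ h : δ ∈ F, (⟨δ, h⟩ : F) ∈ H := by
    intro δ hδ
    have := hs hδ
    simpa using this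
  set m' : Γ → ℤ := fun δ => if δ ∈ s then m δ else 0 with hm'
  have hrel : (fun δ : F => m' δ) ∈ boundedRelations (fun γ : F => (γ : Γ)) n := by
    refine mem_boundedRelations.2 ⟨fun δ => ?_, ?_⟩
    · simp only [hm']
      split_ifs with h
      · exact hm _ h
      · simp
    · rw [Finset.prod_coe_sort F (fun δ => δ ^ m' δ), ← hprod,
        ← Finset.prod_subset (s₁ := s) (fun δ hδ => (hsH δ hδ).1)]
      · exact Finset.prod_congr rfl fun δ hδ => by simp [hm', hδ]
      · intro δ _ hδ
        simp [hm', hδ]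
  have hzero := hH _ hrel fun δ hδ => by
    have : (δ : Γ) ∈ s := by
      by_contra hcon
      exact mem_vecSupport.1 hδ (by simp [hm', hcon])
    exact (hsH δ this).2
  have h0 := congrFun hzero ⟨γ, (hsH γ hγ).1⟩
  simp only [hm', hγ, if_true, Pi.zero_apply] at h0
  rw [h0, zpow_zero]

theorem isDegreeIndependent_of_subset_singleton {Γ : Type*} [CommGroup Γ] (n : ℕ) (γ : Γ) :
    IsDegreeIndependent n ({γ} : Set Γ) := by
  intro s m hs _ hprod δ hδ
  have h1 : s = {δ} := by
    refine Finset.eq_singleton_iff_unique_mem.2 ⟨hδ, fun x hx => ?_⟩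
    rw [Set.mem_singleton_iff.1 (hs hx), Set.mem_singleton_iff.1 (hs hδ)]
  simpa [h1] using hprod

theorem proposition3p3 {G : Type*} [CommGroup G] [TopologicalSpace G] [IsTopologicalGroup G]
    [CompactSpace G] [T2Space G] [MeasurableSpace G] [BorelSpace G]
    (n : ℕ)
    (hΓ : ∀ γ : PontryaginDual G, γ ≠ 1 → IsOfFinOrder γ → n < orderOf γ)
    (E : Set (PontryaginDual G)) (hE : (1 : PontryaginDual G) ∉ E)
    (hSidon : ∀ k : ℕ, 1 ≤ k → k ≤ n → IsSidon ((fun γ : PontryaginDual G => γ ^ k) '' E)) :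
    ∃ δ : ℝ, 0 < δ ∧ ∀ F : Finset (PontryaginDual G), (F : Set (PontryaginDual G)) ⊆ E →
      ∃ H : Finset (PontryaginDual G), H ⊆ F ∧
        IsDegreeIndependent n (H : Set (PontryaginDual G)) ∧
        δ * (F.card : ℝ) ≤ (H.card : ℝ) := by
  classical
  rcases Nat.eq_zero_or_pos n with rfl | hn
  · refine ⟨1, one_pos, fun F _ => ⟨F, Finset.Subset.refl _, fun s m _ hm _ γ hγ => ?_, by simp⟩⟩
    have h0 : m γ = 0 := by simpa using hm γ hγ
    rw [h0, zpow_zero]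
  let m : Measure G := Measure.haarMeasure ⊤
  have hm : IsProbabilityMeasure m :=
    ⟨by simpa using Measure.haarMeasure_self (K₀ := (⊤ : TopologicalSpace.PositiveCompacts G))⟩
  obtain ⟨A, D, hA, hD, hrel⟩ := exists_sum_relations_le m hn hΓ E hSidon
  obtain ⟨q, N₀, hq0, hq1, hN₀, hq⟩ := exists_density hA hD
  -- q/4 serves sets with at least N₀ elements; for smaller nonempty sets one point is already a
  -- proportion N₀⁻¹.
  refine ⟨min (q / 4) N₀⁻¹, by positivity, fun F hF => ?_⟩
  rcases F.eq_empty_or_nonempty with rfl | hFne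
  · exact ⟨∅, Finset.Subset.refl _, fun s _ hs _ _ γ hγ => by simpa using hs hγ, by simp⟩
  rcases le_total N₀ F.card with hN | hN
  · have : Nonempty F := hFne.to_subtype
    obtain ⟨H, hHc, hH⟩ := exists_independent_of_weighted_count
      (fun γ : F => (γ : PontryaginDual G)) n hq0 hq1 <|
        (sum_long_relations_le _ hq0).trans <| by
          rw [Fintype.card_coe]
          exact (mul_le_mul_of_nonneg_left (hrel F hF _ (by positivity))
            (Real.exp_pos _).le).trans (hq _ hN)
    refine ⟨H.map (Function.Embedding.subtype _), fun γ hγ => ?_,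
      isDegreeIndependent_map_subtype n H hH, ?_⟩
    · obtain ⟨δ, -, rfl⟩ := Finset.mem_map.1 hγ
      exact δ.2
    · rw [Finset.card_map]
      rw [Fintype.card_coe] at hHc
      refine le_trans ?_ hHc
      rw [mul_div_right_comm]
      exact mul_le_mul_of_nonneg_right (min_le_left _ _) (Nat.cast_nonneg _)
  · obtain ⟨γ, hγ⟩ := hFne
    refine ⟨{γ}, Finset.singleton_subset_iff.2 hγ, by
      simpa using isDegreeIndependent_of_subset_singleton n γ, ?_⟩
    calc _ ≤ N₀⁻¹ * N₀ := mul_le_mul (min_le_right _ _) hN (Nat.cast_nonneg _) (by positivity)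
      _ = _ := by rw [inv_mul_cancel₀ hN₀.ne']; simp
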